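/- Let $d$ be a natural number and let $p:\mathbb{R}^d\to[0,\infty)$ be a continuously differentiable probability density, i.e. $\int_{\mathbb{R}^d}p\,dx=1$. Let $\phi:\mathbb{R}^d\to\mathbb{R}^d$ be continuously differentiable. The Langevin Stein operator is $$(\mathcal{T}_p\phi)(x)=\nabla\cdot\phi(x)+\phi(x)\cdot\nabla\log p(x),\qquad \nabla\cdot\phi(x)=\sum_{i=1}^d\frac{\partial\phi_i}{\partial x_i}(x),$$ defined at every $x$ with $p(x)>0$, hence almost surely under the law with density $p$. Assume that $\mathbb{E}_{X\sim p}\big[|(\mathcal{T}_p\phi)(X)|\big]<\infty$ and that $$\lim_{R\to\infty}\int_{\partial B_R}p(x)\,\phi(x)\cdot n(x)\,dS(x)=0,$$ where $B_R=\{x:\|x\|_2\le R\}$, $n(x)=x/\|x\|_2$ is the outward unit normal on $\partial B_R$ and $dS$ is the surface measure on $\partial B_R$. Then $$\mathbb{E}_{X\sim p}\big[(\mathcal{T}_p\phi)(X)\big]=0.$$ -/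

import Mathlib

open MeasureTheory Filter Topology
open scoped ENNReal

noncomputable section

/-- The divergence `∇ · φ = ∑ i, ∂ φ_i / ∂ x_i` of a vector field on `ℝ^d`. -/
def divergence {d : ℕ} (φ : EuclideanSpace ℝ (Fin d) → EuclideanSpace ℝ (Fin d))
    (x : EuclideanSpace ℝ (Fin d)) : ℝ :=
  ∑ i : Fin d, fderiv ℝ (fun y => φ y i) x (EuclideanSpace.single i 1)

/-- The Langevin Stein operator `T_p φ = ∇ · φ + φ · ∇ log p`. It has its mathematical meaning at
every point where `p > 0`; the value at a zero of `p` is a convention that the law with density `p`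
does not see. -/
def langevinStein {d : ℕ} (p : EuclideanSpace ℝ (Fin d) → ℝ)
    (φ : EuclideanSpace ℝ (Fin d) → EuclideanSpace ℝ (Fin d))
    (x : EuclideanSpace ℝ (Fin d)) : ℝ :=
  divergence φ x + inner ℝ (φ x) (gradient (fun y => Real.log (p y)) x)

/-- The law on `ℝ^d` with Lebesgue density `p`. -/
def densityLaw {d : ℕ} (p : EuclideanSpace ℝ (Fin d) → ℝ) : Measure (EuclideanSpace ℝ (Fin d)) :=
  (volume : Measure (EuclideanSpace ℝ (Fin d))).withDensity (fun x => ENNReal.ofReal (p x))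

/-- The surface measure `dS` of the sphere `∂B_R`, for `R > 0`, as a measure on `ℝ^d` carried by
that sphere. `Measure.toSphere volume` is the usual surface measure of the unit sphere (the one of
polar coordinates, `dx = r ^ (d - 1) dr dσ`); it is transported by `ω ↦ R ω` and multiplied by
`R ^ (d - 1)`. For `d = 1` it is the counting measure on `{-R, R}`. -/
def sphereSurface (d : ℕ) (R : ℝ) : Measure (EuclideanSpace ℝ (Fin d)) :=
  ENNReal.ofReal (R ^ (d - 1)) •
    Measure.map
      (fun ω : Metric.sphere (0 : EuclideanSpace ℝ (Fin d)) 1 =>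
        R • (ω : EuclideanSpace ℝ (Fin d)))
      (volume : Measure (EuclideanSpace ℝ (Fin d))).toSphere

/-- The flux `∫_{∂B_R} V · n dS` of a vector field `V` through the sphere of radius `R > 0` centred
at the origin, whose outward unit normal at `x` is `n(x) = x / ‖x‖`. -/
def sphereFlux {d : ℕ} (V : EuclideanSpace ℝ (Fin d) → EuclideanSpace ℝ (Fin d)) (R : ℝ) : ℝ :=
  ∫ x, inner ℝ (V x) (‖x‖⁻¹ • x) ∂(sphereSurface d R)

end

/-! Put `V = p • φ`. By `mul_langevinStein` the expectation is the Lebesgue integral of `∇ · V`, and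
the moment assumption says exactly that `∇ · V` is integrable.

Instead of applying the divergence theorem on balls, test against smooth radial cutoffs `η_R`: `∫
η_R ∇ · V = -∫ ∇η_R · V`. The left side tends to `∫ ∇ · V` by dominated convergence. As `∇η_R` is
radial and lives on the shell `R ≤ ‖x‖ ≤ 2R`, polar coordinates turn the right side into an integral
of the sphere fluxes over `r ∈ [R, 2R]`, with weights of total mass bounded in `R`; it vanishes in
the limit (`tendsto_integral_fderiv_radialCutoff`). -/

theorem continuous_divergence {d : ℕ}
    {V : EuclideanSpace ℝ (Fin d) → EuclideanSpace ℝ (Fin d)} (hV : ContDiff ℝ 1 V) :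
    Continuous (divergence V) := by
  have hVi (i : Fin d) : ContDiff ℝ 1 fun y => V y i := by fun_prop
  exact continuous_finsetSum _ fun i _ =>
    ((hVi i).continuous_fderiv one_ne_zero).clm_apply continuous_const

/-- Integration by parts against a compactly supported test function. -/
theorem integral_mul_divergence_eq_neg {d : ℕ}
    {V : EuclideanSpace ℝ (Fin d) → EuclideanSpace ℝ (Fin d)} (hV : ContDiff ℝ 1 V)
    {η : EuclideanSpace ℝ (Fin d) → ℝ} (hη : ContDiff ℝ 1 η) (hc : HasCompactSupport η) :
    ∫ x, η x * divergence V x = -∫ x, fderiv ℝ η x (V x) := by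
  have hVi (i : Fin d) : ContDiff ℝ 1 fun y => V y i := by fun_prop
  have hη' (v : EuclideanSpace ℝ (Fin d)) : Continuous fun x => fderiv ℝ η x v :=
    (hη.continuous_fderiv one_ne_zero).clm_apply continuous_const
  have hV' (i : Fin d) (v : EuclideanSpace ℝ (Fin d)) :
      Continuous fun x => fderiv ℝ (fun y => V y i) x v :=
    ((hVi i).continuous_fderiv one_ne_zero).clm_apply continuous_const
  have hint₁ (i : Fin d) : Integrable fun x =>
      η x * fderiv ℝ (fun y => V y i) x (EuclideanSpace.single i 1) :=
    (hη.continuous.mul (hV' i _)).integrable_of_hasCompactSupport hc.mul_right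
  have hint₂ (i : Fin d) : Integrable fun x =>
      fderiv ℝ η x (EuclideanSpace.single i 1) * V x i :=
    ((hη' _).mul (hVi i).continuous).integrable_of_hasCompactSupport
      (hc.fderiv_apply ℝ _).mul_right
  have hint₃ (i : Fin d) : Integrable fun x => η x * V x i :=
    (hη.continuous.mul (hVi i).continuous).integrable_of_hasCompactSupport hc.mul_right
  have hsum (x : EuclideanSpace ℝ (Fin d)) :
      fderiv ℝ η x (V x) = ∑ i, fderiv ℝ η x (EuclideanSpace.single i 1) * V x i := by
    conv_lhs => rw [← (EuclideanSpace.basisFun (Fin d) ℝ).sum_repr (V x)]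
    simp [mul_comm]
  simp_rw [divergence, Finset.mul_sum, hsum]
  rw [integral_finsetSum _ fun i _ => hint₁ i, integral_finsetSum _ fun i _ => hint₂ i,
    ← Finset.sum_neg_distrib]
  exact Finset.sum_congr rfl fun i _ =>
    integral_mul_fderiv_eq_neg_fderiv_mul_of_integrable (hint₂ i) (hint₁ i) (hint₃ i)
      (fun x _ => hη.differentiable one_ne_zero x) fun x _ => (hVi i).differentiable one_ne_zero x

/-! ### Polar coordinates and sphere fluxes -/

/-- Integration in polar coordinates. -/
theorem integral_eq_integral_Ioi_sphere {E : Type*} [NormedAddCommGroup E] [NormedSpace ℝ E]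
    [FiniteDimensional ℝ E] [Nontrivial E] [MeasurableSpace E] [BorelSpace E] (μ : Measure E)
    [μ.IsAddHaarMeasure] {f : E → ℝ} (hf : Integrable f μ) :
    ∫ x, f x ∂μ = ∫ r in Set.Ioi (0 : ℝ), r ^ (Module.finrank ℝ E - 1) *
      ∫ ω : Metric.sphere (0 : E) 1, f (r • (ω : E)) ∂μ.toSphere := by
  let g : Metric.sphere (0 : E) 1 × Set.Ioi (0 : ℝ) → ℝ := fun z => f (z.2.1 • (z.1 : E))
  have hmp := μ.measurePreserving_homeomorphUnitSphereProd
  have hemb := (homeomorphUnitSphereProd E).measurableEmbedding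
  have hg (x : ({0}ᶜ : Set E)) : g (homeomorphUnitSphereProd E x) = f x := by
    have hx : ‖(x : E)‖ ≠ 0 := norm_ne_zero_iff.2 x.2
    simp [g, smul_smul, hx]
  have hgint : Integrable g (μ.toSphere.prod (Measure.volumeIoiPow (Module.finrank ℝ E - 1))) := by
    rw [← hmp.integrable_comp_emb hemb]
    have : IntegrableOn f ({0}ᶜ : Set E) μ := hf.integrableOn
    rw [integrableOn_iff_comap_subtypeVal (by measurability)] at this
    exact this.congr (.of_forall fun x => (hg x).symm)
  calc ∫ x, f x ∂μ = ∫ x : ({0}ᶜ : Set E), f x ∂(μ.comap (↑)) := by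
        -- Removing the origin costs nothing: a point is null, since `E` is nontrivial.
        rw [integral_subtype_comap (measurableSet_singleton _).compl f, restrict_compl_singleton]
    _ = ∫ z, g z ∂(μ.toSphere.prod (Measure.volumeIoiPow (Module.finrank ℝ E - 1))) := by
        rw [← hmp.integral_comp hemb]
        simp_rw [hg]
    _ = ∫ r, ∫ ω, g (ω, r) ∂μ.toSphere ∂(Measure.volumeIoiPow (Module.finrank ℝ E - 1)) :=
        integral_prod_symm _ hgint
    _ = _ := by
        rw [Measure.volumeIoiPow, integral_withDensity_eq_integral_toReal_smul (by fun_prop)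
          (by simp)]
        rw [integral_subtype_comap measurableSet_Ioi fun r : ℝ =>
          (ENNReal.ofReal (r ^ (Module.finrank ℝ E - 1))).toReal • ∫ ω, f (r • (ω : E)) ∂μ.toSphere]
        refine setIntegral_congr_fun measurableSet_Ioi fun r hr => ?_
        simp [ENNReal.toReal_ofReal (pow_nonneg (le_of_lt hr) _)]

theorem sphereFlux_eq {d : ℕ} {V : EuclideanSpace ℝ (Fin d) → EuclideanSpace ℝ (Fin d)}
    (hV : Continuous V) {R : ℝ} (hR : 0 < R) :
    sphereFlux V R = R ^ (d - 1) *
      ∫ ω : Metric.sphere (0 : EuclideanSpace ℝ (Fin d)) 1,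
        inner ℝ (V (R • (ω : EuclideanSpace ℝ (Fin d)))) (ω : EuclideanSpace ℝ (Fin d))
          ∂(volume : Measure (EuclideanSpace ℝ (Fin d))).toSphere := by
  rw [sphereFlux, sphereSurface, integral_smul_measure, integral_map (by fun_prop)]
  · rw [ENNReal.toReal_ofReal (by positivity), smul_eq_mul]
    congr 1
    refine integral_congr_ae (.of_forall fun ω => ?_)
    simp [norm_smul, smul_smul, abs_of_pos hR, hR.ne']
  · have := hV.measurable
    fun_prop

/-- The fields `g ‖x‖ • x` include the gradients of radial functions. The extra factor `r` comes
from `x = r n(x)` on the sphere of radius `r`. -/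
theorem integral_norm_mul_inner_eq_sphereFlux {d : ℕ} (hd : d ≠ 0)
    {V : EuclideanSpace ℝ (Fin d) → EuclideanSpace ℝ (Fin d)} (hV : Continuous V) {g : ℝ → ℝ}
    (hg : Integrable fun x : EuclideanSpace ℝ (Fin d) => g ‖x‖ * inner ℝ (V x) x) :
    ∫ x, g ‖x‖ * inner ℝ (V x) x = ∫ r in Set.Ioi (0 : ℝ), g r * r * sphereFlux V r := by
  have : NeZero d := ⟨hd⟩
  rw [integral_eq_integral_Ioi_sphere volume hg, finrank_euclideanSpace_fin]
  refine setIntegral_congr_fun measurableSet_Ioi fun r hr => ?_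
  have hr : 0 < r := hr
  simp only [sphereFlux_eq hV hr, norm_smul, norm_eq_of_mem_sphere, inner_smul_right,
    Real.norm_eq_abs, abs_of_pos hr, mul_one, integral_const_mul]
  ring

/-! ### Radial cutoffs -/

/-- A smooth function on the line that is `1` on `(-∞, 1]` and `0` on `[2, ∞)`. -/
noncomputable def lineCutoff (t : ℝ) : ℝ := Real.smoothTransition (2 - t)

theorem contDiff_lineCutoff : ContDiff ℝ 1 lineCutoff :=
  Real.smoothTransition.contDiff (n := 1) |>.comp (contDiff_const.sub contDiff_id)

theorem deriv_lineCutoff_of_lt_one {t : ℝ} (ht : t < 1) : deriv lineCutoff t = 0 := by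
  have : lineCutoff =ᶠ[𝓝 t] fun _ => 1 := by
    filter_upwards [Iio_mem_nhds ht] with s hs
    exact Real.smoothTransition.one_of_one_le (by linarith [Set.mem_Iio.1 hs])
  simp [this.deriv_eq]

theorem deriv_lineCutoff_of_two_lt {t : ℝ} (ht : 2 < t) : deriv lineCutoff t = 0 := by
  have : lineCutoff =ᶠ[𝓝 t] fun _ => 0 := by
    filter_upwards [Ioi_mem_nhds ht] with s hs
    exact Real.smoothTransition.zero_of_nonpos (by linarith [Set.mem_Ioi.1 hs])
  simp [this.deriv_eq]

theorem exists_abs_deriv_lineCutoff_le : ∃ C, 0 ≤ C ∧ ∀ t, |deriv lineCutoff t| ≤ C := by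
  have hcont : Continuous (deriv lineCutoff) := contDiff_lineCutoff.continuous_deriv le_rfl
  have hsupp : HasCompactSupport (deriv lineCutoff) := by
    refine HasCompactSupport.intro (isCompact_Icc (a := (1 : ℝ)) (b := 2)) fun t ht => ?_
    by_cases h : t < 1
    · exact deriv_lineCutoff_of_lt_one h
    · refine deriv_lineCutoff_of_two_lt ?_
      by_contra h2
      exact ht ⟨not_lt.1 h, not_lt.1 h2⟩
  obtain ⟨C, hC⟩ := hcont.bounded_above_of_compact_support hsupp
  exact ⟨C, (norm_nonneg _).trans (hC 0), hC⟩

/-- A smooth radial function that is `1` on the ball of radius `R` and `0` off the ball of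
radius `2 * R`. -/
noncomputable def radialCutoff (d : ℕ) (R : ℝ) (x : EuclideanSpace ℝ (Fin d)) : ℝ :=
  lineCutoff (‖x‖ ^ 2 / R ^ 2)

/-- The squared norm, unlike the norm, is smooth at the origin. -/
theorem contDiff_radialCutoff (d : ℕ) (R : ℝ) : ContDiff ℝ 1 (radialCutoff d R) :=
  contDiff_lineCutoff.comp ((contDiff_norm_sq ℝ).div_const _)

theorem hasCompactSupport_radialCutoff (d : ℕ) {R : ℝ} (hR : 0 < R) :
    HasCompactSupport (radialCutoff d R) := by
  refine HasCompactSupport.intro (isCompact_closedBall 0 (2 * R)) fun x hx => ?_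
  refine Real.smoothTransition.zero_of_nonpos ?_
  rw [mem_closedBall_zero_iff, not_le] at hx
  rw [sub_nonpos, le_div_iff₀ (by positivity)]
  nlinarith

theorem fderiv_radialCutoff (d : ℕ) (R : ℝ) (x v : EuclideanSpace ℝ (Fin d)) :
    fderiv ℝ (radialCutoff d R) x v =
      deriv lineCutoff (‖x‖ ^ 2 / R ^ 2) * (2 / R ^ 2) * inner ℝ v x := by
  have h₁ : HasFDerivAt (fun y : EuclideanSpace ℝ (Fin d) => ‖y‖ ^ 2 / R ^ 2)
      ((R ^ 2)⁻¹ • (2 • innerSL ℝ x)) x := by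
    simpa only [div_eq_inv_mul, id, ContinuousLinearMap.comp_id] using
      ((hasFDerivAt_id x).norm_sq).const_mul ((R ^ 2)⁻¹)
  have h₂ := (contDiff_lineCutoff.differentiable one_ne_zero
    (‖x‖ ^ 2 / R ^ 2)).hasDerivAt.comp_hasFDerivAt x h₁
  have h₃ : HasFDerivAt (radialCutoff d R) _ x := h₂
  rw [h₃.fderiv]
  simp only [_root_.smul_apply, innerSL_apply_apply, smul_eq_mul, nsmul_eq_mul,
    real_inner_comm x v]
  push_cast
  ring

theorem tendsto_integral_fderiv_radialCutoff {d : ℕ} (hd : d ≠ 0)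
    {V : EuclideanSpace ℝ (Fin d) → EuclideanSpace ℝ (Fin d)} (hV : Continuous V)
    (hflux : Tendsto (sphereFlux V) atTop (𝓝 0)) :
    Tendsto (fun R => ∫ x, fderiv ℝ (radialCutoff d R) x (V x)) atTop (𝓝 0) := by
  obtain ⟨C, hC₀, hC⟩ := exists_abs_deriv_lineCutoff_le
  rw [Metric.tendsto_atTop]
  intro ε hε
  -- The radial weight is at most `4 * C / R` on an interval of length `R`, so its mass is at most
  -- `4 * C`; the `+ 1` makes the final inequality strict and covers `C = 0`.
  obtain ⟨N, hN⟩ := Metric.tendsto_atTop.1 hflux (ε / (4 * C + 1)) (by positivity)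
  refine ⟨max N 1, fun R hR => ?_⟩
  have hRN : N ≤ R := (le_max_left _ _).trans hR
  have hR0 : 0 < R := one_pos.trans_le ((le_max_right _ _).trans hR)
  let g : ℝ → ℝ := fun r => deriv lineCutoff (r ^ 2 / R ^ 2) * (2 / R ^ 2)
  have hint : Integrable fun x : EuclideanSpace ℝ (Fin d) => g ‖x‖ * inner ℝ (V x) x := by
    have hcont : Continuous fun x => fderiv ℝ (radialCutoff d R) x (V x) :=
      ((contDiff_radialCutoff d R).continuous_fderiv one_ne_zero).clm_apply hV
    have hsupp : HasCompactSupport fun x => fderiv ℝ (radialCutoff d R) x (V x) :=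
      ((hasCompactSupport_radialCutoff d hR0).fderiv ℝ).mono fun x hx h => hx (by simp [h])
    simpa only [fderiv_radialCutoff] using hcont.integrable_of_hasCompactSupport hsupp
  have heq : ∫ x, fderiv ℝ (radialCutoff d R) x (V x) =
      ∫ r in Set.Icc R (2 * R), g r * r * sphereFlux V r := by
    simp only [fderiv_radialCutoff]
    rw [integral_norm_mul_inner_eq_sphereFlux hd hV hint]
    refine setIntegral_eq_of_subset_of_forall_sdiff_eq_zero (μ := (volume : Measure ℝ))
      (f := fun r => g r * r * sphereFlux V r) measurableSet_Ioi
      (fun r (hr : r ∈ Set.Icc R (2 * R)) => hR0.trans_le hr.1) fun r hr => ?_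
    have hr0 : 0 < r := hr.1
    have : g r = 0 := by
      refine mul_eq_zero_of_left ?_ _
      by_cases h : r < R
      · refine deriv_lineCutoff_of_lt_one ?_
        rw [div_lt_one (by positivity)]
        gcongr
      · refine deriv_lineCutoff_of_two_lt ?_
        have : 2 * R < r := by
          by_contra h2
          exact hr.2 ⟨not_lt.1 h, not_lt.1 h2⟩
        rw [lt_div_iff₀ (by positivity)]
        nlinarith
    simp [this]
  have hbound : ∀ r ∈ Set.Icc R (2 * R),
      ‖g r * r * sphereFlux V r‖ ≤ 4 * C / R * (ε / (4 * C + 1)) := by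
    intro r hr
    have hr0 : 0 < r := hR0.trans_le hr.1
    have h₁ : |sphereFlux V r| ≤ ε / (4 * C + 1) := by
      simpa using (hN r (hRN.trans hr.1)).le
    have h₂ : |g r * r| ≤ 4 * C / R := by
      rw [abs_mul, abs_mul, abs_of_pos hr0, abs_of_pos (show 0 < 2 / R ^ 2 by positivity)]
      calc |deriv lineCutoff (r ^ 2 / R ^ 2)| * (2 / R ^ 2) * r
          ≤ C * (2 / R ^ 2) * (2 * R) := by
            gcongr
            exacts [hC _, hr.2]
        _ = 4 * C / R := by field_simp; ring
    rw [norm_mul, Real.norm_eq_abs, Real.norm_eq_abs]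
    gcongr
  rw [heq, dist_zero_right]
  refine (norm_setIntegral_le_of_norm_le_const (by simp) hbound).trans_lt ?_
  rw [Real.volume_real_Icc_of_le (by linarith)]
  calc 4 * C / R * (ε / (4 * C + 1)) * (2 * R - R) = 4 * C * ε / (4 * C + 1) := by
        field_simp; ring
    _ < ε := by
        rw [div_lt_iff₀ (by positivity)]
        linarith

/-! ### Divergence theorem and Stein identity -/

/-- The divergence theorem on the whole space, with vanishing flux at infinity. -/
theorem integral_divergence_eq_zero {d : ℕ}
    {V : EuclideanSpace ℝ (Fin d) → EuclideanSpace ℝ (Fin d)} (hV : ContDiff ℝ 1 V)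
    (hint : Integrable (divergence V)) (hflux : Tendsto (sphereFlux V) atTop (𝓝 0)) :
    ∫ x, divergence V x = 0 := by
  -- In dimension `0` the divergence is an empty sum, and polar coordinates are not available.
  obtain rfl | hd := eq_or_ne d 0
  · simp [divergence]
  have hlim : Tendsto (fun R => ∫ x, radialCutoff d R x * divergence V x) atTop
      (𝓝 (∫ x, divergence V x)) := by
    refine tendsto_integral_filter_of_dominated_convergence (fun x => ‖divergence V x‖)
      (.of_forall fun R => ((contDiff_radialCutoff d R).continuous.mul
        (continuous_divergence hV)).aestronglyMeasurable)
      (.of_forall fun R => .of_forall fun x => ?_) hint.norm (.of_forall fun x => ?_)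
    · rw [norm_mul]
      refine mul_le_of_le_one_left (norm_nonneg _) ?_
      rw [Real.norm_eq_abs, radialCutoff, lineCutoff, abs_of_nonneg
        (Real.smoothTransition.nonneg _)]
      exact Real.smoothTransition.le_one _
    · refine tendsto_const_nhds.congr' ?_
      filter_upwards [eventually_ge_atTop (max ‖x‖ 1)] with R hR
      have hR0 : 0 < R := one_pos.trans_le ((le_max_right _ _).trans hR)
      have hle : ‖x‖ ^ 2 / R ^ 2 ≤ 1 := by
        rw [div_le_one (by positivity)]
        gcongr
        exact (le_max_left _ _).trans hR
      rw [radialCutoff, lineCutoff, Real.smoothTransition.one_of_one_le (by linarith), one_mul]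
  refine tendsto_nhds_unique hlim ?_
  have h := (tendsto_integral_fderiv_radialCutoff hd hV.continuous hflux).neg
  rw [neg_zero] at h
  refine h.congr' ?_
  filter_upwards [eventually_gt_atTop 0] with R hR
  exact (integral_mul_divergence_eq_neg hV (contDiff_radialCutoff d R)
    (hasCompactSupport_radialCutoff d hR)).symm

theorem divergence_smul {d : ℕ} {p : EuclideanSpace ℝ (Fin d) → ℝ}
    {φ : EuclideanSpace ℝ (Fin d) → EuclideanSpace ℝ (Fin d)} {x : EuclideanSpace ℝ (Fin d)}
    (hp : DifferentiableAt ℝ p x) (hφ : DifferentiableAt ℝ φ x) :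
    divergence (fun y => p y • φ y) x = p x * divergence φ x + fderiv ℝ p x (φ x) := by
  have hφi (i : Fin d) : DifferentiableAt ℝ (fun y => φ y i) x := by fun_prop
  have hsum : fderiv ℝ p x (φ x) = ∑ i, φ x i * fderiv ℝ p x (EuclideanSpace.single i 1) := by
    conv_lhs => rw [← (EuclideanSpace.basisFun (Fin d) ℝ).sum_repr (φ x)]
    simp
  rw [hsum, divergence, divergence, Finset.mul_sum, ← Finset.sum_add_distrib]
  refine Finset.sum_congr rfl fun i _ => ?_
  simp only [PiLp.smul_apply, smul_eq_mul]
  rw [fderiv_fun_mul hp (hφi i)]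
  simp

/-- The identity `p T_p φ = ∇ · (p φ)`; at a zero of `p`, which is a minimum, both sides vanish. -/
theorem mul_langevinStein {d : ℕ} {p : EuclideanSpace ℝ (Fin d) → ℝ}
    {φ : EuclideanSpace ℝ (Fin d) → EuclideanSpace ℝ (Fin d)} {x : EuclideanSpace ℝ (Fin d)}
    (hp_nonneg : ∀ y, 0 ≤ p y) (hp : DifferentiableAt ℝ p x) (hφ : DifferentiableAt ℝ φ x) :
    p x * langevinStein p φ x = divergence (fun y => p y • φ y) x := by
  rw [divergence_smul hp hφ]
  obtain h | h := eq_or_ne (p x) 0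
  · have hmin : IsLocalMin p x := .of_forall fun y => h ▸ hp_nonneg y
    simp [h, hmin.fderiv_eq_zero]
  · rw [langevinStein, inner_gradient_right, (hp.hasFDerivAt.log h).fderiv]
    simp only [_root_.smul_apply, smul_eq_mul, conj_trivial]
    field_simp

theorem mainTheorem4 (d : ℕ)
    (p : EuclideanSpace ℝ (Fin d) → ℝ)
    (φ : EuclideanSpace ℝ (Fin d) → EuclideanSpace ℝ (Fin d))
    (hp : ContDiff ℝ 1 p)
    (hp_nonneg : ∀ x, 0 ≤ p x)
    (hp_one : ∫⁻ x, ENNReal.ofReal (p x) = 1)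
    (hφ : ContDiff ℝ 1 φ)
    (hint : Integrable (langevinStein p φ) (densityLaw p))
    (hflux : Tendsto (fun R : ℝ => sphereFlux (fun x => p x • φ x) R) atTop (𝓝 0)) :
    ∫ x, langevinStein p φ x ∂(densityLaw p) = 0 := by
  have hmeas : Measurable fun x => ENNReal.ofReal (p x) := hp.continuous.measurable.ennreal_ofReal
  have heq : (fun x => (ENNReal.ofReal (p x)).toReal • langevinStein p φ x) =
      divergence fun y => p y • φ y := by
    funext x
    rw [ENNReal.toReal_ofReal (hp_nonneg x), smul_eq_mul]
    exact mul_langevinStein hp_nonneg (hp.differentiable one_ne_zero x)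
      (hφ.differentiable one_ne_zero x)
  rw [densityLaw, integrable_withDensity_iff_integrable_smul' hmeas (by simp), heq] at hint
  rw [densityLaw, integral_withDensity_eq_integral_toReal_smul hmeas (by simp), heq]
  exact integral_divergence_eq_zero (hp.smul hφ) hint hflux
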